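/- Theorem 4.4. Let $G$ be a polycyclic group which is residually nilpotent and nilpotent-by-abelian (that is, $G$ has a nilpotent normal subgroup $N$ with $G/N$ abelian). Let $\gamma_1(G)=G$, $\gamma_{i+1}(G)=[\gamma_i(G),G]$ be the lower central series of $G$, and let $\hat G_{nil}=\varprojlim_i G/\gamma_i(G)$ be the pro-nilpotent completion of $G$, the inverse limit being taken over the natural projections. Then $\hat G_{nil}$ is locally polycyclic, i.e. every finitely generated subgroup of $\hat G_{nil}$ is polycyclic. -/

import Mathlib

/-- A group is polycyclic if it has a finite subnormal series
`1 = H 0 ⊴ H 1 ⊴ ⋯ ⊴ H n = G` all of whose factors `H (i + 1) / H i` are cyclic. -/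
def IsPolycyclic (G : Type*) [Group G] : Prop :=
  ∃ (n : ℕ) (H : ℕ → Subgroup G), H 0 = ⊥ ∧ H n = ⊤ ∧
    ∀ i < n, H i ≤ H (i + 1) ∧
      ∃ _ : ((H i).subgroupOf (H (i + 1))).Normal,
        IsCyclic (↥(H (i + 1)) ⧸ (H i).subgroupOf (H (i + 1)))

/-- A group is locally polycyclic if all its finitely generated subgroups are polycyclic. -/
def IsLocallyPolycyclic (G : Type*) [Group G] : Prop :=
  ∀ H : Subgroup G, H.FG → IsPolycyclic ↥H

/-- A group is residually nilpotent if every nontrivial element survives in some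
nilpotent quotient. -/
def IsResiduallyNilpotent (G : Type*) [Group G] : Prop :=
  ∀ g : G, g ≠ 1 → ∃ (N : Subgroup G) (_ : N.Normal), Group.IsNilpotent (G ⧸ N) ∧ g ∉ N

/-- A group is nilpotent-by-abelian if it has a nilpotent normal subgroup with abelian quotient. -/
def IsNilpotentByAbelian (G : Type*) [Group G] : Prop :=
  ∃ (N : Subgroup G) (_ : N.Normal), Group.IsNilpotent ↥N ∧ ∀ a b : G ⧸ N, a * b = b * a

/-- The quotient of `G` by the `i`-th term of its lower central series. Mathlib indexes the
series from `0`, so this is `G / γ_{i+1}(G)` in the convention `γ_1(G) = G`. -/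
abbrev LowerCentralQuotient (G : Type*) [Group G] (i : ℕ) : Type _ :=
  G ⧸ (⊤ : Subgroup G).lowerCentralSeries i

/-- The natural projection between the lower central quotients of `G`, for `i ≤ j`. -/
def lowerCentralQuotientMap (G : Type*) [Group G] {i j : ℕ} (h : i ≤ j) :
    LowerCentralQuotient G j →* LowerCentralQuotient G i :=
  QuotientGroup.map _ _ (MonoidHom.id G) ((⊤ : Subgroup G).lowerCentralSeries_antitone h)

/-- The pro-nilpotent completion of `G`: the inverse limit of its lower central quotients, as
the group of compatible families in the product of these quotients. -/
def proNilpotentCompletion (G : Type*) [Group G] :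
    Subgroup ((i : ℕ) → LowerCentralQuotient G i) where
  carrier := {x | ∀ (i j : ℕ) (h : i ≤ j), lowerCentralQuotientMap G h (x j) = x i}
  one_mem' := fun _ _ _ => map_one _
  mul_mem' := fun hx hy i j h => by
    rw [Pi.mul_apply, Pi.mul_apply, map_mul, hx i j h, hy i j h]
  inv_mem' := fun hx i j h => by
    rw [Pi.inv_apply, Pi.inv_apply, map_inv, hx i j h]

/-! Let `N` be nilpotent and normal with `G/N` abelian. The closures in the completion of the chain
`G ≥ γ_1(N) ≥ γ_2(N) ≥ ... ≥ 1` form a finite filtration with abelian factors, so it is enough that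
conjugation is locally finite on each factor (`isLocallyPolycyclic_of_filtration`).

Two facts give this. Modulo `N`, an element of the completion is a single `g` in `G`, and `N` acts
trivially on each factor, so only conjugations by `G` matter (`exists_forall_proj_eq`). Each section
of the chain in `G` is a finitely generated abelian group, so its endomorphism ring is a Noetherian
`ℤ`-module and finitely many conjugations span all of them (`exists_finite_conj_combinations`). This
relation passes to the closures. -/

open Subgroup
open scoped commutatorElement

/-! ### Polycyclic subgroups of an ambient group -/

/-- Subgroups obtained from the trivial one by finitely many extensions by cyclic groups. -/
inductive IsPolycyclicSubgroup {Γ : Type*} [Group Γ] : Subgroup Γ → Prop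
  | bot : IsPolycyclicSubgroup ⊥
  | sup_zpowers {K : Subgroup Γ} {x : Γ} (hK : IsPolycyclicSubgroup K)
      (hx : x ∈ normalizer (K : Set Γ)) : IsPolycyclicSubgroup (K ⊔ zpowers x)

theorem mem_sup_zpowers_of_mem_normalizer {Γ : Type*} [Group Γ] {K : Subgroup Γ} {x : Γ}
    (hx : x ∈ normalizer (K : Set Γ)) {y : Γ} :
    y ∈ K ⊔ zpowers x ↔ ∃ k ∈ K, ∃ n : ℤ, k * x ^ n = y := by
  rw [← SetLike.mem_coe, coe_mul_of_right_le_normalizer_left K _ (zpowers_le.2 hx), Set.mem_mul]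
  constructor
  · rintro ⟨k, hk, _, ⟨n, rfl⟩, rfl⟩
    exact ⟨k, hk, n, rfl⟩
  · rintro ⟨k, hk, n, rfl⟩
    exact ⟨k, hk, _, ⟨n, rfl⟩, rfl⟩

theorem IsPolycyclicSubgroup.fg {Γ : Type*} [Group Γ] {K : Subgroup Γ}
    (hK : IsPolycyclicSubgroup K) : K.FG := by
  induction hK with
  | bot => exact Subgroup.FG.bot
  | sup_zpowers _ _ ih =>
    exact ih.sup ⟨{_}, by rw [Finset.coe_singleton, zpowers_eq_closure]⟩

/-- The exponents `n` for which the coset `K x ^ n` meets `H` form a subgroup `dℤ`; one element of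
`H` in `K x ^ d` generates `H` over `H ⊓ K`. -/
theorem IsPolycyclicSubgroup.of_le {Γ : Type*} [Group Γ] {K : Subgroup Γ}
    (hK : IsPolycyclicSubgroup K) {H : Subgroup Γ} (hH : H ≤ K) : IsPolycyclicSubgroup H := by
  induction hK generalizing H with
  | bot =>
    rw [le_bot_iff.1 hH]
    exact .bot
  | @sup_zpowers K x _ hx ih =>
    have hinf := ih (inf_le_right : H ⊓ K ≤ K)
    let E : AddSubgroup ℤ :=
      { carrier := {n | ∃ k ∈ K, k * x ^ n ∈ H}
        zero_mem' := ⟨1, K.one_mem, by simp⟩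
        add_mem' := by
          rintro a b ⟨k, hk, hka⟩ ⟨l, hl, hlb⟩
          refine ⟨k * (x ^ a * l * (x ^ a)⁻¹), K.mul_mem hk
            ((mem_normalizer_iff.1 (zpow_mem hx a) l).1 hl), ?_⟩
          convert H.mul_mem hka hlb using 1
          rw [zpow_add]; group
        neg_mem' := by
          rintro a ⟨k, hk, hka⟩
          refine ⟨(x ^ a)⁻¹ * k⁻¹ * x ^ a, ?_, ?_⟩
          · exact (mem_normalizer_iff''.1 (zpow_mem hx a) k⁻¹).1 (K.inv_mem hk)
          · convert H.inv_mem hka using 1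
            group }
    obtain ⟨d, hd⟩ := Int.subgroup_cyclic E
    have hdE : d ∈ E := hd ▸ AddSubgroup.subset_closure rfl
    obtain ⟨k, hk, hkH⟩ := hdE
    have hkx : k * x ^ d ∈ normalizer (K : Set Γ) := mul_mem (le_normalizer hk) (zpow_mem hx d)
    have hy : k * x ^ d ∈ normalizer ((H ⊓ K : Subgroup Γ) : Set Γ) :=
      inf_normalizer_le_normalizer_inf ⟨le_normalizer hkH, hkx⟩
    convert IsPolycyclicSubgroup.sup_zpowers hinf hy
    apply le_antisymm
    · intro h hh
      obtain ⟨l, hl, n, rfl⟩ := (mem_sup_zpowers_of_mem_normalizer hx).1 (hH hh)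
      have hn : n ∈ E := ⟨l, hl, hh⟩
      rw [hd, AddSubgroup.mem_closure_singleton] at hn
      obtain ⟨m, rfl⟩ := hn
      refine (mem_sup_zpowers_of_mem_normalizer hy).2
        ⟨l * x ^ (m • d) * ((k * x ^ d) ^ m)⁻¹, ⟨?_, ?_⟩, m, by group⟩
      · exact H.mul_mem hh (H.inv_mem (H.zpow_mem hkH m))
      · have key : ∀ m : ℤ, ∃ k' ∈ K, (k * x ^ d) ^ m = k' * x ^ (m • d) := by
          intro m
          induction m with
          | zero => exact ⟨1, K.one_mem, by simp⟩
          | succ i hi =>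
            obtain ⟨k', hk', h⟩ := hi
            refine ⟨k' * (x ^ ((i : ℤ) • d) * k * (x ^ ((i : ℤ) • d))⁻¹), K.mul_mem hk'
              ((mem_normalizer_iff.1 (zpow_mem hx _) k).1 hk), ?_⟩
            rw [zpow_add_one, h, add_smul, one_smul, zpow_add]; group
          | pred i hi =>
            obtain ⟨k', hk', h⟩ := hi
            refine ⟨k' * (x ^ ((-(i : ℤ) - 1) • d) * k⁻¹ * (x ^ ((-(i : ℤ) - 1) • d))⁻¹),
              K.mul_mem hk' ((mem_normalizer_iff.1 (zpow_mem hx _) _).1 (K.inv_mem hk)), ?_⟩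
            rw [zpow_sub_one, h, sub_smul, one_smul, zpow_sub]; group
        obtain ⟨k', hk', h⟩ := key m
        rw [h]
        simpa [mul_assoc] using K.mul_mem hl (K.inv_mem hk')
    · exact sup_le inf_le_left (zpowers_le.2 hkH)

theorem mem_normalizer_sup_closure {Γ : Type*} [Group Γ] {K : Subgroup Γ} {S : Set Γ} {x : Γ}
    (hx : x ∈ normalizer (K : Set Γ)) (h₁ : ∀ t ∈ S, x * t * x⁻¹ ∈ K ⊔ closure S)
    (h₂ : ∀ t ∈ S, x⁻¹ * t * x ∈ K ⊔ closure S) :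
    x ∈ normalizer ((K ⊔ closure S : Subgroup Γ) : Set Γ) := by
  have key : ∀ y ∈ normalizer (K : Set Γ), (∀ t ∈ S, y * t * y⁻¹ ∈ K ⊔ closure S) →
      ∀ z ∈ K ⊔ closure S, y * z * y⁻¹ ∈ K ⊔ closure S := by
    intro y hy h
    suffices K ⊔ closure S ≤ (K ⊔ closure S).comap (MulAut.conj y).toMonoidHom from
      fun z hz => this hz
    refine sup_le (fun z hz => ?_) ((closure_le _).2 h)
    exact mem_sup_left ((mem_normalizer_iff.1 hy z).1 hz)
  refine mem_normalizer_iff.2 fun z => ⟨key x hx h₁ z, fun hz => ?_⟩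
  simpa [mul_assoc] using key x⁻¹ (inv_mem hx) (by simpa using h₂) _ hz

/-- Since `K` contains the commutators, the elements of `S` can be adjoined one at a time, each
normalizing what precedes. -/
theorem IsPolycyclicSubgroup.sup_closure {Γ : Type*} [Group Γ] {K : Subgroup Γ}
    (hK : IsPolycyclicSubgroup K) {S : Set Γ} (hS : S.Finite)
    (hn : ∀ s ∈ S, s ∈ normalizer (K : Set Γ)) (hc : ∀ s ∈ S, ∀ t ∈ S, ⁅s, t⁆ ∈ K) :
    IsPolycyclicSubgroup (K ⊔ closure S) := by
  induction S, hS using Set.Finite.induction_on with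
  | empty => simpa using hK
  | @insert s S _ _ ih =>
    have h := ih (fun t ht => hn t (.inr ht)) (fun t ht u hu => hc t (.inr ht) u (.inr hu))
    rw [← Set.union_singleton, Subgroup.closure_union, ← sup_assoc, ← zpowers_eq_closure]
    refine .sup_zpowers h ?_
    have hs := hn s (.inl rfl)
    have hst : ∀ t ∈ S, ⁅s, t⁆ ∈ K := fun t ht => hc s (.inl rfl) t (.inr ht)
    refine mem_normalizer_sup_closure hs (fun t ht => ?_) (fun t ht => ?_)
    · simpa [commutatorElement_def] using
        mul_mem (mem_sup_left (hst t ht)) (mem_sup_right (subset_closure ht))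
    · have := (mem_normalizer_iff''.1 hs _).1 (inv_mem (hst t ht))
      simpa [commutatorElement_def, mul_assoc] using
        mul_mem (mem_sup_left this) (mem_sup_right (subset_closure ht))

theorem IsPolycyclicSubgroup.exists_series {Γ : Type*} [Group Γ] {K : Subgroup Γ}
    (hK : IsPolycyclicSubgroup K) :
    ∃ (n : ℕ) (H : ℕ → Subgroup Γ), H 0 = ⊥ ∧ H n = K ∧
      ∀ i < n, ∃ x ∈ normalizer (H i : Set Γ), H (i + 1) = H i ⊔ zpowers x := by
  induction hK with
  | bot => exact ⟨0, fun _ => ⊥, rfl, rfl, by simp⟩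
  | @sup_zpowers K x _ hx ih =>
    obtain ⟨n, H, h0, hn, hs⟩ := ih
    refine ⟨n + 1, fun i => if i ≤ n then H i else K ⊔ zpowers x, by simpa using h0, by simp, ?_⟩
    intro i hi
    rcases Nat.lt_succ_iff_lt_or_eq.1 hi with hi | rfl
    · simpa [hi.le, Nat.succ_le_of_lt hi] using hs i hi
    · exact ⟨x, by simpa [hn] using hx, by simp [hn]⟩

theorem IsPolycyclicSubgroup.isPolycyclic {Γ : Type*} [Group Γ] {K : Subgroup Γ}
    (hK : IsPolycyclicSubgroup K) : IsPolycyclic ↥K := by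
  obtain ⟨n, H, h0, hn, hs⟩ := hK.exists_series
  have hle : ∀ i ≤ n, H i ≤ K := by
    intro i hi
    induction hi using Nat.decreasingInduction with
    | self => exact hn.le
    | of_succ k hk ih =>
      obtain ⟨x, -, hx⟩ := hs k hk
      exact (hx ▸ le_sup_left).trans ih
  refine ⟨n, fun i => (H i).subgroupOf K, by simp [h0], by simp [hn], ?_⟩
  intro i hi
  obtain ⟨x, hx, hsucc⟩ := hs i hi
  have hmono : H i ≤ H (i + 1) := hsucc ▸ le_sup_left
  have hxmem : x ∈ H (i + 1) := hsucc ▸ mem_sup_right (mem_zpowers x)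
  have hnorm : H (i + 1) ≤ normalizer (H i : Set Γ) :=
    hsucc ▸ sup_le le_normalizer (zpowers_le.2 hx)
  have hnormal : (((H i).subgroupOf K).subgroupOf ((H (i + 1)).subgroupOf K)).Normal :=
    normal_subgroupOf_of_le_normalizer fun y hy =>
      le_normalizer_comap K.subtype (hnorm hy)
  refine ⟨fun y hy => hmono hy, hnormal, ?_⟩
  refine ⟨QuotientGroup.mk ⟨⟨x, hle _ hi hxmem⟩, hxmem⟩, ?_⟩
  intro q
  induction q using QuotientGroup.induction_on with
  | H y =>
    obtain ⟨⟨y, hyK⟩, hy⟩ := y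
    have hy' : y ∈ H i ⊔ zpowers x := hsucc ▸ hy
    obtain ⟨k, hk, m, rfl⟩ := (mem_sup_zpowers_of_mem_normalizer hx).1 hy'
    refine ⟨m, ?_⟩
    change QuotientGroup.mk _ ^ m = _
    rw [← QuotientGroup.mk_zpow, QuotientGroup.eq]
    change (x ^ m)⁻¹ * (k * x ^ m) ∈ H i
    rw [← mul_assoc]
    exact (mem_normalizer_iff''.1 (zpow_mem hx m) k).1 hk

theorem IsPolycyclic.isPolycyclicSubgroup_top {G : Type*} [Group G] (hG : IsPolycyclic G) :
    IsPolycyclicSubgroup (⊤ : Subgroup G) := by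
  obtain ⟨n, H, h0, hn, hs⟩ := hG
  suffices ∀ i ≤ n, IsPolycyclicSubgroup (H i) from hn ▸ this n le_rfl
  intro i
  induction i with
  | zero => exact fun _ => h0 ▸ .bot
  | succ i ih =>
    intro hi
    obtain ⟨hle, hnormal, ⟨q, hq⟩⟩ := hs i hi
    induction q using QuotientGroup.induction_on with
    | H x =>
      obtain ⟨x, hx⟩ := x
      have hxn : x ∈ normalizer (H i : Set G) := le_normalizer_of_normal_subgroupOf hle hx
      convert IsPolycyclicSubgroup.sup_zpowers (ih (by omega)) hxn
      refine le_antisymm (fun y hy => ?_) (sup_le hle (zpowers_le.2 hx))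
      obtain ⟨m, hm⟩ := hq (QuotientGroup.mk ⟨y, hy⟩)
      change QuotientGroup.mk _ ^ m = _ at hm
      rw [← QuotientGroup.mk_zpow, QuotientGroup.eq] at hm
      replace hm : (x ^ m)⁻¹ * y ∈ H i := hm
      have := mul_mem (mem_sup_right (zpow_mem (mem_zpowers x) m) : x ^ m ∈ H i ⊔ zpowers x)
        (mem_sup_left hm)
      simpa using this

/-! ### Local polycyclicity from a filtration -/

/-- A group filtered by normal subgroups with abelian factors is locally polycyclic as soon as the
conjugation action on each factor is locally finite. -/
theorem isLocallyPolycyclic_of_filtration {Γ : Type*} [Group Γ] (F : ℕ → Subgroup Γ) (m : ℕ)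
    (h0 : F 0 = ⊤) (hm : F m = ⊥) (hF : ∀ j, (F j).Normal) (hmono : ∀ j, F (j + 1) ≤ F j)
    (hcomm : ∀ j, ⁅F j, F j⁆ ≤ F (j + 1))
    (hfin : ∀ j, ∀ S : Set Γ, S.Finite → S ⊆ F j → ∃ T : Set Γ, T.Finite ∧ S ⊆ T ∧ T ⊆ F j ∧
      ∀ h : Γ, ∀ t ∈ T, h * t * h⁻¹ ∈ closure T ⊔ F (j + 1)) :
    IsLocallyPolycyclic Γ := by
  -- Normalization by an arbitrary finite `X` is what lets the induction ascend from `F (j + 1)` to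
  -- `F j`.
  have key : ∀ j ≤ m, ∀ X : Set Γ, X.Finite → ∀ S : Set Γ, S.Finite → S ⊆ F j →
      ∃ L : Subgroup Γ, IsPolycyclicSubgroup L ∧ L ≤ F j ∧ S ⊆ L ∧
        ∀ x ∈ X, x ∈ normalizer (L : Set Γ) := by
    intro j hj
    induction hj using Nat.decreasingInduction with
    | self =>
      intro X _ S _ hS
      exact ⟨⊥, .bot, bot_le, hm ▸ hS, fun x _ => by
        rw [normalizer_eq_top]; trivial⟩
    | of_succ j _ ih =>
      intro X hX S hS hSF
      obtain ⟨T, hT, hST, hTF, hTact⟩ := hfin j S hS hSF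
      have := hF (j + 1)
      have hdec : ∀ h : Γ, ∀ t : T, ∃ u ∈ F (j + 1), ∃ w ∈ closure T, w * u = h * t * h⁻¹ := by
        intro h t
        obtain ⟨w, hw, u, hu, e⟩ := mem_sup_of_normal_right.1 (hTact h t t.2)
        exact ⟨u, hu, w, hw, e⟩
      choose u huF w hw huw using hdec
      have := hT.to_subtype
      -- The next `L` must absorb the errors `u` of conjugating `T` by `X`, in both directions, and
      -- the commutators of `T`; it must also be normalized by `T`.
      have hfin₁ : (Set.image2 u (X ∪ X⁻¹) Set.univ).Finite :=
        (hX.union hX.inv).image2 _ Set.finite_univ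
      have hfin₂ : (Set.image2 (fun s t : Γ => ⁅s, t⁆) T T).Finite := hT.image2 _ hT
      obtain ⟨L, hL, hLF, hUL, hXL⟩ := ih (X ∪ T) (hX.union hT) _ (hfin₁.union hfin₂) (by
        rintro _ (⟨x, _, t, _, rfl⟩ | ⟨s, hs, t, ht, rfl⟩)
        · exact huF x t
        · exact hcomm j (commutator_mem_commutator (hTF hs) (hTF ht)))
      have hact : ∀ x ∈ X ∪ X⁻¹, ∀ t ∈ T, x * t * x⁻¹ ∈ L ⊔ closure T := by
        intro x hx t ht
        rw [← huw x ⟨t, ht⟩]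
        exact mul_mem (mem_sup_right (hw _ _))
          (mem_sup_left (hUL (.inl ⟨x, hx, ⟨t, ht⟩, trivial, rfl⟩)))
      refine ⟨L ⊔ closure T, hL.sup_closure hT (fun t ht => hXL t (.inr ht))
        (fun s hs t ht => hUL (.inr ⟨s, hs, t, ht, rfl⟩)),
        sup_le (hLF.trans (hmono j)) ((closure_le _).2 hTF),
        fun s hs => mem_sup_right (subset_closure (hST hs)), fun x hx => ?_⟩
      refine mem_normalizer_sup_closure (hXL x (.inl hx)) (hact x (.inl hx)) fun t ht => ?_
      simpa using hact x⁻¹ (.inr (by simpa using hx)) t ht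
  rintro H ⟨S, rfl⟩
  obtain ⟨L, hL, -, hSL, -⟩ := key 0 (Nat.zero_le m) ∅ Set.finite_empty S S.finite_toSet
    (by simp [h0])
  exact (hL.of_le ((closure_le _).2 hSL)).isPolycyclic

/-! ### Conjugation on finitely generated abelian sections -/

/-- The endomorphisms in a family acting on a finitely generated abelian group are integral
combinations of finitely many members of the family. -/
theorem exists_finite_integral_combinations {ι A : Type*} [CommGroup A] [Group.FG A]
    (ρ : ι → A →* A) :
    ∃ t : Finset ι, ∀ i, ∃ n : ι → ℤ, ∀ a, ρ i a = ∏ k ∈ t, ρ k a ^ n k := by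
  classical
  let φ : ι → Additive A →ₗ[ℤ] Additive A := fun i => (MonoidHom.toAdditive (ρ i)).toIntLinearMap
  have : Module.Finite ℤ (Additive A) := Module.Finite.iff_addGroup_fg.2 inferInstance
  have hfg : (Submodule.span ℤ (Set.range φ)).FG := IsNoetherian.noetherian _
  obtain ⟨s, hs, hspan⟩ := (Submodule.fg_span_iff_fg_span_finset_subset _).1 hfg
  obtain ⟨t, ht⟩ := (Finset.subset_set_image_iff (s := Set.univ) (f := φ) (t := s)).1
    (by simpa using hs)
  refine ⟨t, fun i => ?_⟩
  have hi : φ i ∈ Submodule.span ℤ (φ '' t) := by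
    have : φ i ∈ Submodule.span ℤ (Set.range φ) := Submodule.subset_span ⟨i, rfl⟩
    rw [hspan, ← ht.2] at this
    simpa using this
  obtain ⟨n, hn⟩ := (Submodule.mem_span_image_finset_iff_exists_fun' ℤ).1 hi
  refine ⟨n, fun a => ?_⟩
  have := congrArg (fun f => Additive.toMul (f (Additive.ofMul a))) hn
  simp only [LinearMap.sum_apply, LinearMap.smul_apply, toMul_sum, toMul_zsmul] at this
  exact this.symm

/-- On an abelian section `D / E` with `D` finitely generated, conjugation by any element is an
integral combination of conjugations by finitely many fixed elements. -/
theorem exists_finite_conj_combinations {G : Type*} [Group G] {D E : Subgroup G} [D.Normal]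
    [E.Normal] (hD : D.FG) (hc : ⁅D, D⁆ ≤ E) :
    ∃ t : Finset G, ∀ g, ∃ n : G → ℤ, ∀ a ∈ D,
      (t.toList.map fun k => (k * a * k⁻¹) ^ n k).prod⁻¹ * (g * a * g⁻¹) ∈ E := by
  have : Group.FG D := (Group.fg_iff_subgroup_fg D).2 hD
  let _ : CommGroup (D ⧸ E.subgroupOf D) :=
    { (inferInstance : Group (D ⧸ E.subgroupOf D)) with
      mul_comm := by
        intro x y
        induction x using QuotientGroup.induction_on with
        | H x =>
        induction y using QuotientGroup.induction_on with
        | H y =>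
        rw [← QuotientGroup.mk_mul, ← QuotientGroup.mk_mul, QuotientGroup.eq]
        have := hc (commutator_mem_commutator (inv_mem y.2) (inv_mem x.2))
        simpa [commutatorElement_def, mem_subgroupOf, mul_assoc] using this }
  let c : G → D ⧸ E.subgroupOf D →* D ⧸ E.subgroupOf D := fun g =>
    QuotientGroup.map _ _ (MulAut.conjNormal g : MulAut D).toMonoidHom fun x hx => by
      simpa [mem_subgroupOf] using Normal.conj_mem ‹E.Normal› x.1 hx g
  obtain ⟨t, ht⟩ := exists_finite_integral_combinations c
  refine ⟨t, fun g => ?_⟩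
  obtain ⟨n, hn⟩ := ht g
  -- The exponents do not depend on `a`, so they will serve all components of an element of the
  -- completion at once.
  refine ⟨n, fun a ha => ?_⟩
  have h := hn (QuotientGroup.mk ⟨a, ha⟩)
  rw [← Finset.prod_map_toList] at h
  have h2 : (t.toList.map fun k => c k (QuotientGroup.mk ⟨a, ha⟩) ^ n k) =
      (t.toList.map fun k => (MulAut.conjNormal k : MulAut D) ⟨a, ha⟩ ^ n k).map
        (QuotientGroup.mk' (E.subgroupOf D)) := by
    rw [List.map_map]; rfl
  rw [h2, ← map_list_prod] at h
  have h3 := QuotientGroup.eq.1 h.symm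
  rw [mem_subgroupOf] at h3
  simpa [SubmonoidClass.coe_list_prod, List.map_map, Function.comp_def] using h3

/-! ### Closures in the pro-nilpotent completion -/

namespace proNilpotentCompletion

variable (G : Type*) [Group G]

/-- The canonical map from a group to its pro-nilpotent completion. -/
def of : G →* proNilpotentCompletion G where
  toFun g := ⟨fun _ => QuotientGroup.mk g, fun _ _ _ => rfl⟩
  map_one' := rfl
  map_mul' _ _ := rfl

/-- The projections of the pro-nilpotent completion. -/
def proj (i : ℕ) : proNilpotentCompletion G →* LowerCentralQuotient G i :=
  (Pi.evalMonoidHom _ i).comp (proNilpotentCompletion G).subtype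

variable {G}

theorem proj_of (i : ℕ) (g : G) : proj G i (of G g) = QuotientGroup.mk g := rfl

theorem ext {x y : proNilpotentCompletion G} (h : ∀ i, proj G i x = proj G i y) : x = y :=
  Subtype.ext (funext h)

/-- The closure in the pro-nilpotent completion of the image of a subgroup. -/
def closureMap (D : Subgroup G) : Subgroup (proNilpotentCompletion G) :=
  ⨅ i, (D.map (QuotientGroup.mk' _)).comap (proj G i)

theorem mem_closureMap {D : Subgroup G} {x : proNilpotentCompletion G} :
    x ∈ closureMap D ↔ ∀ i, ∃ d ∈ D, QuotientGroup.mk d = proj G i x := by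
  simp [closureMap, mem_iInf]

instance closureMap_normal (D : Subgroup G) [hD : D.Normal] : (closureMap D).Normal :=
  normal_iInf_normal fun i =>
    (hD.map (QuotientGroup.mk' _) (QuotientGroup.mk'_surjective _)).comap (proj G i)

theorem closureMap_mono {D E : Subgroup G} (h : D ≤ E) : closureMap D ≤ closureMap E := by
  intro x hx
  rw [mem_closureMap] at hx ⊢
  exact fun i => (hx i).imp fun d hd => ⟨h hd.1, hd.2⟩

theorem closureMap_top : closureMap (⊤ : Subgroup G) = ⊤ := by
  refine eq_top_iff.2 fun x _ => mem_closureMap.2 fun i => ?_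
  obtain ⟨g, hg⟩ := QuotientGroup.mk_surjective (proj G i x)
  exact ⟨g, trivial, hg⟩

theorem closureMap_bot : closureMap (⊥ : Subgroup G) = ⊥ := by
  refine eq_bot_iff.2 fun x hx => ext fun i => ?_
  obtain ⟨d, hd, h⟩ := mem_closureMap.1 hx i
  rw [mem_bot.1 hd] at h
  exact h.symm

theorem commutator_closureMap_le (D : Subgroup G) :
    ⁅closureMap D, closureMap D⁆ ≤ closureMap ⁅D, D⁆ := by
  rw [commutator_le]
  intro x hx y hy
  rw [mem_closureMap] at hx hy ⊢
  intro i
  obtain ⟨a, ha, hax⟩ := hx i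
  obtain ⟨b, hb, hby⟩ := hy i
  exact ⟨⁅a, b⁆, commutator_mem_commutator ha hb, by
    rw [map_commutatorElement, ← hax, ← hby]; rfl⟩

/-- If `N` has abelian quotient, an element of the pro-nilpotent completion agrees with a single
element of `G` modulo `N` in all components. -/
theorem exists_forall_proj_eq {N : Subgroup G} (hN : ⁅(⊤ : Subgroup G), ⊤⁆ ≤ N)
    (x : proNilpotentCompletion G) :
    ∃ g : G, ∀ i, ∃ n ∈ N, proj G i x = QuotientGroup.mk (g * n) := by
  -- Component `1` is the abelianization, which already determines the class modulo `N`.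
  obtain ⟨g, hg⟩ := QuotientGroup.mk_surjective (proj G 1 x)
  refine ⟨g, fun i => ?_⟩
  obtain ⟨d, hd⟩ := QuotientGroup.mk_surjective (proj G i x)
  rcases i with _ | i
  · refine ⟨1, N.one_mem, ?_⟩
    rw [← hd, QuotientGroup.eq]
    trivial
  · refine ⟨g⁻¹ * d, hN ?_, by rw [← hd, mul_inv_cancel_left]⟩
    have h : lowerCentralQuotientMap G (Nat.le_add_left 1 i) (proj G (i + 1) x) = proj G 1 x :=
      x.2 1 (i + 1) _
    rw [← hd, ← hg] at h
    exact QuotientGroup.eq.1 h.symm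

theorem exists_locally_finite_conj {N D E : Subgroup G} [D.Normal] [E.Normal]
    (hN : ⁅(⊤ : Subgroup G), ⊤⁆ ≤ N) (hD : D.FG) (hc : ⁅D, D⁆ ≤ E) (hDN : ⁅D, N⁆ ≤ E)
    {S : Set (proNilpotentCompletion G)} (hS : S.Finite) (hSD : S ⊆ closureMap D) :
    ∃ T : Set (proNilpotentCompletion G), T.Finite ∧ S ⊆ T ∧ T ⊆ closureMap D ∧
      ∀ h, ∀ t ∈ T, h * t * h⁻¹ ∈ closure T ⊔ closureMap E := by
  obtain ⟨t, ht⟩ := exists_finite_conj_combinations hD hc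
  let T := Set.image2 (fun k s => of G k * s * (of G k)⁻¹) (insert 1 (t : Set G)) S
  have key : ∀ h, ∀ s ∈ S, h * s * h⁻¹ ∈ closure T ⊔ closureMap E := by
    intro h s hs
    obtain ⟨g, hg⟩ := exists_forall_proj_eq hN h
    obtain ⟨n, hn⟩ := ht g
    let W := (t.toList.map fun k => (of G k * s * (of G k)⁻¹) ^ n k).prod
    have hW : W ∈ closure T := by
      refine list_prod_mem fun w hw => ?_
      obtain ⟨k, hk, rfl⟩ := List.mem_map.1 hw
      have hkT : of G k * s * (of G k)⁻¹ ∈ T := ⟨k, .inr (by simpa using hk), s, hs, rfl⟩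
      exact zpow_mem (Subgroup.subset_closure hkT) _
    have hE : W⁻¹ * (h * s * h⁻¹) ∈ closureMap E := by
      rw [mem_closureMap]
      intro i
      obtain ⟨u, hu, hui⟩ := hg i
      obtain ⟨a, ha, hai⟩ := mem_closureMap.1 (hSD hs) i
      let w := (t.toList.map fun k => (k * a * k⁻¹) ^ n k).prod
      have hw : proj G i W = QuotientGroup.mk w := by
        change proj G i W = QuotientGroup.mk' _ w
        simp only [W, w, map_list_prod, List.map_map]
        congr 2
        ext k
        simp only [Function.comp_apply, map_zpow, map_mul, map_inv, proj_of, ← hai]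
        rfl
      -- The second factor, a conjugate of `⁅a⁻¹, u⁆`, turns conjugation of `a` by `g` into
      -- conjugation by `g * u`.
      have hmem := E.mul_mem (hn a ha)
        (Normal.conj_mem ‹E.Normal› _ (hDN (commutator_mem_commutator (inv_mem ha) hu)) g)
      refine ⟨_, hmem, ?_⟩
      simp only [map_mul, map_inv, hw, ← hai, hui, ← QuotientGroup.mk_mul, ← QuotientGroup.mk_inv]
      congr 1
      simp [w, commutatorElement_def, mul_assoc]
    simpa using mul_mem (mem_sup_left hW) (mem_sup_right hE)
  refine ⟨T, (t.finite_toSet.insert 1).image2 _ hS, fun s hs => ⟨1, .inl rfl, s, hs, by simp⟩,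
    ?_, ?_⟩
  · rintro _ ⟨k, _, s, hs, rfl⟩
    exact Normal.conj_mem inferInstance s (hSD hs) _
  -- A further conjugation by `k` is absorbed into `h`, so `key` on `S` suffices.
  · rintro h _ ⟨k, _, s, hs, rfl⟩
    simpa [mul_assoc] using key (h * of G k) s hs

end proNilpotentCompletion

/-! ### The filtration by the lower central series of `N` -/

open proNilpotentCompletion in
theorem theorem4p4 (G : Type*) [Group G] (hpoly : IsPolycyclic G)
    (hres : IsResiduallyNilpotent G) (hnba : IsNilpotentByAbelian G) :
    IsLocallyPolycyclic ↥(proNilpotentCompletion G) := by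
  obtain ⟨N, hNn, hnil, hab⟩ := hnba
  have hN : ⁅(⊤ : Subgroup G), ⊤⁆ ≤ N := by
    rw [commutator_le]
    intro a _ b _
    rw [← QuotientGroup.eq_one_iff, ← QuotientGroup.mk'_apply, map_commutatorElement,
      commutatorElement_eq_one_iff_mul_comm]
    exact hab _ _
  obtain ⟨m, hm⟩ := (isNilpotent_iff_lowerCentralSeries N).1 hnil
  -- The index is shifted by one: `D 1` is `N`, hence `D (m + 1) = ⊥`.
  let D : ℕ → Subgroup G := fun j => j.casesOn ⊤ N.lowerCentralSeries
  have hnormal : ∀ j, (D j).Normal := by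
    rintro (_ | j)
    · exact inferInstanceAs (⊤ : Subgroup G).Normal
    · exact N.lowerCentralSeries_normal j
  have hmono : ∀ j, D (j + 1) ≤ D j := by
    rintro (_ | j)
    · exact le_top
    · exact N.lowerCentralSeries_antitone j.le_succ
  have hDN : ∀ j, ⁅D j, N⁆ ≤ D (j + 1) := by
    rintro (_ | j)
    · exact commutator_le_right _ _
    · exact le_rfl
  have hDD : ∀ j, ⁅D j, D j⁆ ≤ D (j + 1) := by
    rintro (_ | j)
    · exact hN
    · exact (commutator_mono le_rfl (N.lowerCentralSeries_antitone j.zero_le)).trans (hDN (j + 1))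
  have hD0 : D 0 = ⊤ := rfl
  have hDm : D (m + 1) = ⊥ := hm
  clear_value D
  refine isLocallyPolycyclic_of_filtration (fun j => closureMap (D j)) (m + 1)
    (by rw [hD0, closureMap_top]) (by rw [hDm, closureMap_bot]) (fun j => closureMap_normal (D j))
    (fun j => closureMap_mono (hmono j))
    (fun j => (commutator_closureMap_le _).trans (closureMap_mono (hDD j))) fun j S hS hSD => ?_
  exact exists_locally_finite_conj hN (hpoly.isPolycyclicSubgroup_top.of_le le_top).fg
    (hDD j) (hDN j) hS hSD
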